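/- Let $K\ge 0$ and $d_1,\dots,d_K$ be integers, let a slate be a vector $a=(a_1,\dots,a_K)$ with $a_k\in\{1,\dots,d_k\}$, and let $(X_i,A_i,R_i)$, $i=1,2,\dots$, be independent copies of a triplet $(X,A,R)$ of a context, a slate and a real reward, where $X\sim P_X$, $A\sim\mu(\cdot\mid X)$ and $R\sim\mathbb P(\cdot\mid A,X)$. Assume that the logging policy is factored, $\mu(a\mid x)=\prod_{k=1}^K\mu_k(a_k\mid x)$. Let $\pi(\cdot\mid x)$ be a fixed target policy on slates (not necessarily factored), let $\pi(a_k\mid x)$ denote the probability it gives to action $a_k$ in slot $k$, and assume that $\pi(a_k\mid x)=0$ whenever $\mu_k(a_k\mid x)=0$, for $P_X$-almost every $x$. Put $$Y_k=\frac{\pi(A_k\mid X)}{\mu_k(A_k\mid X)},\qquad G=1+\sum_{k=1}^K(Y_k-1),\qquad \theta=\mathbb E[GR],$$ and assume $\mathbb E[(GR)^2]<\infty$ and $\mathbb E[Y_k^2]<\infty$ for every $k$. For $w\in\mathbb R^K$ let $$\Gamma_w=GR-\sum_{k=1}^K w_k(Y_k-1),\qquad \hat\theta_n^{(w)}=\mathbb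 E_n[\Gamma_w],\qquad V_w=\operatorname{Var}(\Gamma_w),\qquad V^*=\inf_{w\in\mathbb R^K}V_w,$$ where $\mathbb E_n[f(X,A,R)]=\frac1n\sum_{i=1}^n f(X_i,A_i,R_i)$. Define the data-driven weights $\hat w^*_n=(\hat w^*_{n,1},\dots,\hat w^*_{n,K})$ by $$\hat w^*_{n,k}=\frac{\mathbb E_n[GR(Y_k-1)]}{\mathbb E_n[(Y_k-1)^2]},$$ with $0/0=0$ (if the denominator vanishes then so does the numerator, and $\hat\theta_n^{(w)}$ does not depend on $w_k$). Then, as $n\to\infty$, $$\sqrt n\,\bigl(\hat\theta_n^{(\hat w^*_n)}-\theta\bigr)\to_d\mathcal N(0,V^*),$$ where $\mathcal N(0,0)$ is the point mass at $0$. That is, the feasible estimator with data-driven weights attains the smallest asymptotic variance in the class $\{\hat\theta_n^{(w)}:w\in\mathbb R^K\}$. -/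

import Mathlib

open MeasureTheory ProbabilityTheory Filter
open scoped NNReal

noncomputable section

namespace SlateOPE

/-- The slates with `K` slots and `d k` available actions in slot `k`. -/
abbrev Slate {K : ℕ} (d : Fin K → ℕ) : Type := (k : Fin K) → Fin (d k)

/-- The triplets (context, slate, reward), arranged as `((x, a), r)`. -/
abbrev Triplet (𝒳 : Type*) {K : ℕ} (d : Fin K → ℕ) : Type _ := (𝒳 × Slate d) × ℝ

variable {𝒳 : Type*} [MeasurableSpace 𝒳] {K : ℕ} {d : Fin K → ℕ}

/-- The law of a generic triplet: `X ∼ PX`, `A ∼ μ(· ∣ X)`, `R ∼ ρ(· ∣ X, A)`. -/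
def law (PX : Measure 𝒳) (μ : Kernel 𝒳 (Slate d)) (ρ : Kernel (𝒳 × Slate d) ℝ) :
    Measure (Triplet 𝒳 d) :=
  (PX ⊗ₘ μ) ⊗ₘ ρ

/-- The slot-level marginal `π(a_k ∣ x)` of a policy `π` on slates: the probability that slot `k`
receives action `j`. -/
def slotMarginal (π : Kernel 𝒳 (Slate d)) (k : Fin K) (x : 𝒳) (j : Fin (d k)) : ℝ :=
  (π x).real {a | a k = j}

/-- The policy `μ` is factored with slot policies `μs k`, for `PX`-almost every context. -/
def IsFactored (PX : Measure 𝒳) (μ : Kernel 𝒳 (Slate d))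
    (μs : (k : Fin K) → Kernel 𝒳 (Fin (d k))) : Prop :=
  ∀ᵐ x ∂PX, ∀ a : Slate d, (μ x).real {a} = ∏ k, (μs k x).real {a k}

/-- Slot-level coverage: for `PX`-almost every context, an action that the slot policy `μs k` never
takes is not taken in slot `k` by the target policy `π` either. -/
def Covers (PX : Measure 𝒳) (μs : (k : Fin K) → Kernel 𝒳 (Fin (d k)))
    (π : Kernel 𝒳 (Slate d)) : Prop :=
  ∀ᵐ x ∂PX, ∀ k, ∀ j : Fin (d k), (μs k x).real {j} = 0 → slotMarginal π k x j = 0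

/-- The slot-level density ratio `Y_k = π(A_k ∣ X) / μ_k(A_k ∣ X)`. -/
def Y (μs : (k : Fin K) → Kernel 𝒳 (Fin (d k))) (π : Kernel 𝒳 (Slate d)) (k : Fin K)
    (z : Triplet 𝒳 d) : ℝ :=
  slotMarginal π k z.1.1 (z.1.2 k) / (μs k z.1.1).real {z.1.2 k}

/-- `G = 1 + ∑ k, (Y_k - 1)`. -/
def G (μs : (k : Fin K) → Kernel 𝒳 (Fin (d k))) (π : Kernel 𝒳 (Slate d))
    (z : Triplet 𝒳 d) : ℝ :=
  1 + ∑ k, (Y μs π k z - 1)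

/-- The product `G R`. -/
def GR (μs : (k : Fin K) → Kernel 𝒳 (Fin (d k))) (π : Kernel 𝒳 (Slate d))
    (z : Triplet 𝒳 d) : ℝ :=
  G μs π z * z.2

/-- `Γ_w = G R - ∑ k, w_k (Y_k - 1)`. -/
def Gam (μs : (k : Fin K) → Kernel 𝒳 (Fin (d k))) (π : Kernel 𝒳 (Slate d)) (w : Fin K → ℝ)
    (z : Triplet 𝒳 d) : ℝ :=
  GR μs π z - ∑ k, w k * (Y μs π k z - 1)

/-- The estimand `θ = 𝔼[G R]`, for the law `P` of the triplet. -/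
def theta (P : Measure (Triplet 𝒳 d)) (μs : (k : Fin K) → Kernel 𝒳 (Fin (d k)))
    (π : Kernel 𝒳 (Slate d)) : ℝ :=
  ∫ z, GR μs π z ∂P

/-- `V_w = Var(Γ_w)`, for the law `P` of the triplet. -/
def V (P : Measure (Triplet 𝒳 d)) (μs : (k : Fin K) → Kernel 𝒳 (Fin (d k)))
    (π : Kernel 𝒳 (Slate d)) (w : Fin K → ℝ) : ℝ :=
  variance (Gam μs π w) P

/-- `V* = inf_w V_w`, the infimum over all weight vectors `w ∈ ℝ^K`. -/
def Vstar (P : Measure (Triplet 𝒳 d)) (μs : (k : Fin K) → Kernel 𝒳 (Fin (d k)))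
    (π : Kernel 𝒳 (Slate d)) : ℝ :=
  ⨅ w : Fin K → ℝ, V P μs π w

/-- `V*` is a genuine infimum: no truncation happens when it is read as a nonnegative real. -/
theorem Vstar_nonneg (P : Measure (Triplet 𝒳 d)) (μs : (k : Fin K) → Kernel 𝒳 (Fin (d k)))
    (π : Kernel 𝒳 (Slate d)) : 0 ≤ Vstar P μs π :=
  Real.iInf_nonneg fun _ => variance_nonneg _ _

/-- The empirical mean `𝔼_n[f] = (1 / n) ∑_{i < n} f(z_i)` over the first `n` observations. -/
def empMean (z : ℕ → Triplet 𝒳 d) (n : ℕ) (f : Triplet 𝒳 d → ℝ) : ℝ :=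
  (1 / (n : ℝ)) * ∑ i ∈ Finset.range n, f (z i)

/-- The estimator `θ̂_n^{(w)} = 𝔼_n[Γ_w]`. -/
def thetaHat (μs : (k : Fin K) → Kernel 𝒳 (Fin (d k))) (π : Kernel 𝒳 (Slate d))
    (z : ℕ → Triplet 𝒳 d) (n : ℕ) (w : Fin K → ℝ) : ℝ :=
  empMean z n (Gam μs π w)

/-- The data-driven weights `ŵ*_{n,k} = 𝔼_n[G R (Y_k - 1)] / 𝔼_n[(Y_k - 1)²]`. If the denominator
vanishes then `Y_k = 1` at all `n` observations, so that `𝔼_n[Γ_w]` does not depend on `w_k`. -/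
def wHat (μs : (k : Fin K) → Kernel 𝒳 (Fin (d k))) (π : Kernel 𝒳 (Slate d))
    (z : ℕ → Triplet 𝒳 d) (n : ℕ) (k : Fin K) : ℝ :=
  empMean z n (fun t => GR μs π t * (Y μs π k t - 1)) /
    empMean z n (fun t => (Y μs π k t - 1) ^ 2)

end SlateOPE

end

/-!
The weights `E[g y] / E[y²]` minimize `Var (g - ∑ w_k y_k)` when the control variates `y_k` are
centred and orthogonal. Replacing weights `w` by estimates `ŵ` changes the normalized error of the
sample mean by `∑ (w_k - ŵ_k) √n 𝔼_n[y_k]`: the factor `√n 𝔼_n[y_k]` converges in distribution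
because `y_k` is centred, so by Slutsky consistency of `ŵ`, with no rate, makes the change
negligible. For slates, `y_k = Y_k - 1`: given the context, a factored logging policy is a product
measure, under which products of `Y_k - 1` over distinct slots have mean zero.
-/

open scoped Topology

section ConvergenceInDistribution

variable {Ω Ω' ι E : Type*} [MeasurableSpace Ω] [MeasurableSpace Ω'] {Q : Measure Ω}
  [IsProbabilityMeasure Q] {Q' : Measure Ω'} [IsProbabilityMeasure Q'] {l : Filter ι}
  [MeasurableSpace E]

theorem tendstoInMeasure_of_tendstoInDistribution_const [PseudoEMetricSpace E]
    [OpensMeasurableSpace E] {U : ι → Ω → E} {c : E}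
    (h : TendstoInDistribution U l (fun _ : Ω' => c) (fun _ => Q) Q') :
    TendstoInMeasure Q U l (fun _ => c) := by
  intro ε hε
  have hclosed : IsClosed {x : E | ε ≤ edist x c} :=
    isClosed_le continuous_const (by fun_prop)
  have hlimit : (Q'.map fun _ : Ω' => c) {x : E | ε ≤ edist x c} = 0 := by
    rw [Measure.map_apply measurable_const hclosed.measurableSet]
    simp [hε.ne']
  have hlimsup := ProbabilityMeasure.limsup_measure_closed_le_of_tendsto h.tendsto hclosed
  simp only [ProbabilityMeasure.coe_mk, hlimit] at hlimsup
  refine (tendsto_of_le_liminf_of_limsup_le zero_le hlimsup).congr fun i => ?_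
  exact Measure.map_apply_of_aemeasurable (h.forall_aemeasurable i) hclosed.measurableSet

theorem tendstoInMeasure_mul_sub_of_tendstoInDistribution [NonUnitalSeminormedRing E]
    [SecondCountableTopology E] [BorelSpace E] [l.IsCountablyGenerated]
    {U D : ι → Ω → E} {Z : Ω' → E} {c : E} (hU : TendstoInDistribution U l Z (fun _ => Q) Q')
    (hD : TendstoInMeasure Q D l (fun _ => c)) (hDm : ∀ i, AEMeasurable (D i) Q) :
    TendstoInMeasure Q (fun i ω => U i ω * (c - D i ω)) l (fun _ => 0) := by
  have h := hU.continuous_comp_prodMk_of_tendstoInMeasure_const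
    (g := fun p : E × E => p.1 * (c - p.2)) (by fun_prop) hD hDm
  simp only [sub_self, mul_zero] at h
  exact tendstoInMeasure_of_tendstoInDistribution_const h

theorem tendstoInDistribution_add_sum_of_tendstoInMeasure_zero [SeminormedAddCommGroup E]
    [SecondCountableTopology E] [BorelSpace E] [l.IsCountablyGenerated] {κ : Type*}
    {U : ι → Ω → E} {Z : Ω' → E} {D : κ → ι → Ω → E}
    (hU : TendstoInDistribution U l Z (fun _ => Q) Q')
    (hD : ∀ k, TendstoInMeasure Q (D k) l (fun _ => 0)) (hDm : ∀ k i, AEMeasurable (D k i) Q)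
    (s : Finset κ) :
    TendstoInDistribution (fun i ω => U i ω + ∑ k ∈ s, D k i ω) l Z (fun _ => Q) Q' := by
  classical
  induction s using Finset.induction_on with
  | empty => simpa using hU
  | insert k s hk ih =>
    refine (ih.add_of_tendstoInMeasure_const (hD k) (hDm k)).congr
      (fun i => ae_of_all _ fun ω => ?_) (ae_of_all _ fun x => add_zero _)
    simp only [Pi.add_apply, Finset.sum_insert hk]
    abel

end ConvergenceInDistribution

section SampleMean

/-- The empirical mean `𝔼_n[f]` over the first `n` observations, for an arbitrary observation space
(`SlateOPE.empMean` is the case of triplets). For `n = 0` it is `0`. -/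
noncomputable def sampleMean {𝓩 : Type*} (z : ℕ → 𝓩) (n : ℕ) (f : 𝓩 → ℝ) : ℝ :=
  (1 / (n : ℝ)) * ∑ i ∈ Finset.range n, f (z i)

variable {𝓩 Ω : Type*} [MeasurableSpace 𝓩] [MeasurableSpace Ω] {P : Measure 𝓩}
  {Q : Measure Ω} {z : ℕ → Ω → 𝓩} {f : 𝓩 → ℝ}

theorem identDistrib_comp_of_hasLaw {E : Type*} [MeasurableSpace E] {f : 𝓩 → E} {z : Ω → 𝓩}
    (hz : HasLaw z P Q) (hf : AEMeasurable f P) : IdentDistrib (fun ω => f (z ω)) f Q P :=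
  have hfP : HasLaw f (P.map f) P := ⟨hf, rfl⟩
  (hfP.fun_comp hz).identDistrib hfP

theorem aemeasurable_sampleMean (hz : ∀ i, HasLaw (z i) P Q) (hf : AEMeasurable f P) (n : ℕ) :
    AEMeasurable (fun ω => sampleMean (fun i => z i ω) n f) Q :=
  (Finset.aemeasurable_fun_sum _ fun i _ =>
    (identDistrib_comp_of_hasLaw (hz i) hf).aemeasurable_fst).const_mul _

theorem ae_tendsto_sampleMean (hz : ∀ i, HasLaw (z i) P Q)
    (hind : Pairwise fun i j => IndepFun (z i) (z j) Q) (hf : Integrable f P) :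
    ∀ᵐ ω ∂Q, Tendsto (fun n => sampleMean (fun i => z i ω) n f) atTop (𝓝 (∫ t, f t ∂P)) := by
  have hident (i : ℕ) := identDistrib_comp_of_hasLaw (hz i) hf.aemeasurable
  have hindf : Pairwise fun i j => IndepFun (fun ω => f (z i ω)) (fun ω => f (z j ω)) Q :=
    fun i j hij => (hind hij).comp₀ (hz i).aemeasurable (hz j).aemeasurable
      ((hz i).map_eq.symm ▸ hf.aemeasurable) ((hz j).map_eq.symm ▸ hf.aemeasurable)
  have hslln := strong_law_ae_real (fun i ω => f (z i ω)) ((hident 0).integrable_iff.2 hf)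
    hindf fun i => (hident i).trans (hident 0).symm
  filter_upwards [hslln] with ω hω
  rw [(hident 0).integral_eq] at hω
  exact hω.congr fun n => by rw [sampleMean, one_div_mul_eq_div]

theorem tendstoInDistribution_sqrt_mul_sampleMean_sub [IsProbabilityMeasure Q]
    (hz : ∀ i, HasLaw (z i) P Q) (hind : iIndepFun z Q) (hf : MemLp f 2 P) :
    TendstoInDistribution
      (fun (n : ℕ) ω => √(n : ℝ) * (sampleMean (fun i => z i ω) n f - ∫ t, f t ∂P))
      atTop id (fun _ => Q) (gaussianReal 0 (variance f P).toNNReal) := by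
  have hident (i : ℕ) := identDistrib_comp_of_hasLaw (hz i) hf.aemeasurable
  have hindf : iIndepFun (fun i ω => f (z i ω)) Q :=
    hind.comp₀ (fun _ => f) (fun i => (hz i).aemeasurable)
      fun i => (hz i).map_eq.symm ▸ hf.aemeasurable
  have hclt := tendstoInDistribution_inv_sqrt_mul_sum_sub (P := Q)
    (P' := gaussianReal 0 (variance f P).toNNReal) (Y := id)
    ((hident 0).variance_eq ▸ HasLaw.id) ((hident 0).memLp_iff.2 hf) hindf
    fun i => (hident i).trans (hident 0).symm
  refine hclt.congr (fun n => ae_of_all _ fun ω => ?_) (ae_eq_refl _)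
  simp only [(hident 0).integral_eq, sampleMean]
  rcases n.eq_zero_or_pos with rfl | hn
  · simp
  · have hsqrt : √(n : ℝ) ^ 2 = n := Real.sq_sqrt n.cast_nonneg
    have hsqrt_ne : √(n : ℝ) ≠ 0 := by positivity
    field_simp
    rw [hsqrt]

end SampleMean

section LinearResidual

/-- The integrand `g - ∑ k, w k * y k` of the estimator of `E[g]` with control variates `y k` and
weights `w k`; for slates this is `Γ_w`. -/
def linearResidual {𝓩 ι : Type*} [Fintype ι] (g : 𝓩 → ℝ) (y : ι → 𝓩 → ℝ) (w : ι → ℝ) (t : 𝓩) :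
    ℝ :=
  g t - ∑ k, w k * y k t

/-- The coefficient `E[g y] / E[y²]` of the least-squares projection of `g` onto `y`. If `y`
vanishes almost everywhere, it is `0`. -/
noncomputable def regressionCoeff {𝓩 : Type*} [MeasurableSpace 𝓩] (P : Measure 𝓩) (g y : 𝓩 → ℝ) :
    ℝ :=
  (∫ t, g t * y t ∂P) / ∫ t, y t ^ 2 ∂P

variable {𝓩 ι : Type*} [Fintype ι]

theorem sampleMean_linearResidual (z : ℕ → 𝓩) (n : ℕ) (g : 𝓩 → ℝ) (y : ι → 𝓩 → ℝ) (w : ι → ℝ) :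
    sampleMean z n (linearResidual g y w) =
      sampleMean z n g - ∑ k, w k * sampleMean z n (y k) := by
  simp only [sampleMean, linearResidual, Finset.sum_sub_distrib, mul_sub, Finset.mul_sum]
  rw [Finset.sum_comm]
  simp only [mul_left_comm]

theorem linearResidual_eq_sub_sum_sub_mul (g : 𝓩 → ℝ) (y : ι → 𝓩 → ℝ) (v w : ι → ℝ) :
    linearResidual g y w =
      fun t => linearResidual g y v t - ∑ k, (w k - v k) * y k t := by
  funext t
  simp only [linearResidual, sub_mul, Finset.sum_sub_distrib]
  ring

variable [MeasurableSpace 𝓩] {P : Measure 𝓩}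

theorem ae_eq_zero_of_integral_sq_eq_zero {y : 𝓩 → ℝ} (hy : MemLp y 2 P)
    (h : ∫ t, y t ^ 2 ∂P = 0) : y =ᵐ[P] 0 := by
  filter_upwards [(integral_eq_zero_iff_of_nonneg (fun t => sq_nonneg (y t)) hy.integrable_sq).1 h]
    with t ht
  exact pow_eq_zero_iff two_ne_zero |>.1 ht

theorem regressionCoeff_mul_integral_sq (g : 𝓩 → ℝ) {y : 𝓩 → ℝ} (hy : MemLp y 2 P) :
    regressionCoeff P g y * ∫ t, y t ^ 2 ∂P = ∫ t, g t * y t ∂P := by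
  by_cases h : ∫ t, y t ^ 2 ∂P = 0
  · rw [h, mul_zero, eq_comm]
    refine integral_eq_zero_of_ae ?_
    filter_upwards [ae_eq_zero_of_integral_sq_eq_zero hy h] with t ht
    simp [ht]
  · exact div_mul_cancel₀ _ h

theorem covariance_eq_integral_mul_of_integral_eq_zero [IsProbabilityMeasure P] {f y : 𝓩 → ℝ}
    (hf : MemLp f 2 P) (hy : MemLp y 2 P) (hmean : ∫ t, y t ∂P = 0) :
    covariance f y P = ∫ t, f t * y t ∂P := by
  rw [covariance_eq_sub hf hy, hmean, mul_zero, sub_zero]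
  rfl

variable {g : 𝓩 → ℝ} {y : ι → 𝓩 → ℝ}

theorem memLp_sum_mul {p : ENNReal} (hy : ∀ k, MemLp (y k) p P) (w : ι → ℝ) :
    MemLp (fun t => ∑ k, w k * y k t) p P :=
  memLp_finsetSum _ fun k _ => (hy k).const_mul (w k)

theorem memLp_linearResidual {p : ENNReal} (hg : MemLp g p P) (hy : ∀ k, MemLp (y k) p P)
    (w : ι → ℝ) : MemLp (linearResidual g y w) p P :=
  hg.sub (memLp_sum_mul hy w)

theorem integral_linearResidual (hg : Integrable g P) (hy : ∀ k, Integrable (y k) P)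
    (hmean : ∀ k, ∫ t, y k t ∂P = 0) (w : ι → ℝ) :
    ∫ t, linearResidual g y w t ∂P = ∫ t, g t ∂P := by
  have hwy : ∀ k ∈ Finset.univ, Integrable (fun t => w k * y k t) P :=
    fun k _ => (hy k).const_mul _
  simp only [linearResidual]
  rw [integral_sub hg (integrable_finsetSum _ hwy), integral_finsetSum _ hwy]
  simp [integral_const_mul, hmean]

variable [IsProbabilityMeasure P]

theorem covariance_linearResidual_regressionCoeff (hg : MemLp g 2 P) (hy : ∀ k, MemLp (y k) 2 P)
    (hmean : ∀ k, ∫ t, y k t ∂P = 0)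
    (horth : Pairwise fun k l => ∫ t, y k t * y l t ∂P = 0) (l : ι) :
    covariance (linearResidual g y fun k => regressionCoeff P g (y k)) (y l) P = 0 := by
  have hcov {f : 𝓩 → ℝ} (hf : MemLp f 2 P) : covariance f (y l) P = ∫ t, f t * y l t ∂P :=
    covariance_eq_integral_mul_of_integral_eq_zero hf (hy l) (hmean l)
  calc covariance (linearResidual g y fun k => regressionCoeff P g (y k)) (y l) P
      = (∫ t, g t * y l t ∂P) - ∑ k, regressionCoeff P g (y k) * ∫ t, y k t * y l t ∂P := by
        unfold linearResidual
        rw [covariance_fun_sub_left hg (memLp_sum_mul hy _) (hy l),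
          covariance_fun_sum_left (fun k => (hy k).const_mul _) (hy l), hcov hg]
        simp_rw [covariance_const_mul_left, hcov (hy _)]
    _ = (∫ t, g t * y l t ∂P) - regressionCoeff P g (y l) * ∫ t, y l t ^ 2 ∂P := by
        rw [Fintype.sum_eq_single l fun k hk => by rw [horth hk, mul_zero]]
        simp_rw [pow_two]
    _ = 0 := by rw [regressionCoeff_mul_integral_sq g (hy l), sub_self]

theorem variance_linearResidual (hg : MemLp g 2 P) (hy : ∀ k, MemLp (y k) 2 P)
    (hmean : ∀ k, ∫ t, y k t ∂P = 0)
    (horth : Pairwise fun k l => ∫ t, y k t * y l t ∂P = 0) (w : ι → ℝ) :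
    variance (linearResidual g y w) P =
      variance (linearResidual g y fun k => regressionCoeff P g (y k)) P +
        variance (fun t => ∑ k, (w k - regressionCoeff P g (y k)) * y k t) P := by
  have hres := memLp_linearResidual hg hy fun k => regressionCoeff P g (y k)
  have huncorrelated : covariance (linearResidual g y fun k => regressionCoeff P g (y k))
      (fun t => ∑ k, (w k - regressionCoeff P g (y k)) * y k t) P = 0 := by
    rw [covariance_fun_sum_right (fun k => (hy k).const_mul _) hres]
    refine Finset.sum_eq_zero fun k _ => ?_
    rw [covariance_const_mul_right,
      covariance_linearResidual_regressionCoeff hg hy hmean horth, mul_zero]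
  rw [linearResidual_eq_sub_sum_sub_mul g y (fun k => regressionCoeff P g (y k)) w,
    variance_fun_sub hres (memLp_sum_mul hy _), huncorrelated, mul_zero, sub_zero]

theorem iInf_variance_linearResidual (hg : MemLp g 2 P) (hy : ∀ k, MemLp (y k) 2 P)
    (hmean : ∀ k, ∫ t, y k t ∂P = 0)
    (horth : Pairwise fun k l => ∫ t, y k t * y l t ∂P = 0) :
    ⨅ w, variance (linearResidual g y w) P =
      variance (linearResidual g y fun k => regressionCoeff P g (y k)) P := by
  have hbdd : BddBelow (Set.range fun w => variance (linearResidual g y w) P) :=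
    ⟨0, Set.forall_mem_range.2 fun _ => variance_nonneg _ _⟩
  refine le_antisymm (ciInf_le hbdd _) (le_ciInf fun w => ?_)
  rw [variance_linearResidual hg hy hmean horth w]
  exact le_add_of_nonneg_right (variance_nonneg _ _)

end LinearResidual

section EstimatedWeights

/-- The empirical regression coefficient `𝔼_n[g y] / 𝔼_n[y²]`, which estimates `regressionCoeff`. If
`y` vanishes at all `n` observations, it is `0`. -/
noncomputable def sampleRegressionCoeff {𝓩 : Type*} (z : ℕ → 𝓩) (n : ℕ) (g y : 𝓩 → ℝ) : ℝ :=
  sampleMean z n (fun t => g t * y t) / sampleMean z n (fun t => y t ^ 2)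

variable {𝓩 Ω ι : Type*} [MeasurableSpace 𝓩] [MeasurableSpace Ω] [Fintype ι] {P : Measure 𝓩}
  {Q : Measure Ω} {z : ℕ → Ω → 𝓩} {g : 𝓩 → ℝ}

theorem aemeasurable_sampleRegressionCoeff (hz : ∀ i, HasLaw (z i) P Q) {y : 𝓩 → ℝ}
    (hg : AEMeasurable g P) (hy : AEMeasurable y P) (n : ℕ) :
    AEMeasurable (fun ω => sampleRegressionCoeff (fun i => z i ω) n g y) Q :=
  (aemeasurable_sampleMean hz (hg.mul hy) n).div (aemeasurable_sampleMean hz (hy.pow_const 2) n)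

theorem ae_tendsto_sampleRegressionCoeff (hz : ∀ i, HasLaw (z i) P Q)
    (hind : Pairwise fun i j => IndepFun (z i) (z j) Q) {y : 𝓩 → ℝ} (hg : MemLp g 2 P)
    (hy : MemLp y 2 P) :
    ∀ᵐ ω ∂Q, Tendsto (fun n => sampleRegressionCoeff (fun i => z i ω) n g y) atTop
      (𝓝 (regressionCoeff P g y)) := by
  by_cases h : ∫ t, y t ^ 2 ∂P = 0
  · have hzero : ∀ᵐ ω ∂Q, ∀ i, y (z i ω) = 0 := ae_all_iff.2 fun i =>
      ae_of_ae_map (hz i).aemeasurable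
        ((hz i).map_eq.symm ▸ ae_eq_zero_of_integral_sq_eq_zero hy h)
    filter_upwards [hzero] with ω hω
    simp [sampleRegressionCoeff, sampleMean, regressionCoeff, hω, h]
  · filter_upwards [ae_tendsto_sampleMean hz hind (hg.integrable_mul hy),
      ae_tendsto_sampleMean hz hind hy.integrable_sq] with ω hnum hden
    exact hnum.div hden h

variable [IsProbabilityMeasure Q] {y : ι → 𝓩 → ℝ}

theorem tendstoInDistribution_sampleMean_linearResidual_of_tendstoInMeasure
    (hz : ∀ i, HasLaw (z i) P Q) (hind : iIndepFun z Q) (hg : MemLp g 2 P)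
    (hy : ∀ k, MemLp (y k) 2 P) (hmean : ∀ k, ∫ t, y k t ∂P = 0) {w : ι → ℝ}
    {W : ℕ → Ω → ι → ℝ} (hWm : ∀ k n, AEMeasurable (fun ω => W n ω k) Q)
    (hW : ∀ k, TendstoInMeasure Q (fun n ω => W n ω k) atTop fun _ => w k) :
    TendstoInDistribution
      (fun (n : ℕ) ω => √(n : ℝ) *
        (sampleMean (fun i => z i ω) n (linearResidual g y (W n ω)) - ∫ t, g t ∂P))
      atTop id (fun _ => Q) (gaussianReal 0 (variance (linearResidual g y w) P).toNNReal) := by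
  have : IsProbabilityMeasure P := (hz 0).isProbabilityMeasure_iff.1 ‹_›
  have hclt := tendstoInDistribution_sqrt_mul_sampleMean_sub hz hind (memLp_linearResidual hg hy w)
  have hcorrection (k : ι) : TendstoInMeasure Q
      (fun (n : ℕ) ω => √(n : ℝ) * sampleMean (fun i => z i ω) n (y k) * (w k - W n ω k))
      atTop (fun _ => 0) := by
    have hmean_clt := tendstoInDistribution_sqrt_mul_sampleMean_sub hz hind (hy k)
    simp only [hmean, sub_zero] at hmean_clt
    exact tendstoInMeasure_mul_sub_of_tendstoInDistribution hmean_clt (hW k) (hWm k)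
  have hcorrection_aemeasurable (k : ι) (n : ℕ) : AEMeasurable
      (fun ω => √(n : ℝ) * sampleMean (fun i => z i ω) n (y k) * (w k - W n ω k)) Q :=
    ((aemeasurable_sampleMean hz (hy k).aemeasurable n).const_mul _).mul ((hWm k n).const_sub _)
  refine (tendstoInDistribution_add_sum_of_tendstoInMeasure_zero hclt hcorrection
    hcorrection_aemeasurable Finset.univ).congr (fun n => ae_of_all _ fun ω => ?_) (ae_eq_refl _)
  simp only [integral_linearResidual (hg.integrable one_le_two)
    (fun k => (hy k).integrable one_le_two) hmean, sampleMean_linearResidual, mul_sub,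
    Finset.sum_sub_distrib, Finset.mul_sum, mul_assoc, mul_comm (sampleMean _ _ _)]
  ring

theorem tendstoInDistribution_sampleMean_linearResidual_sampleRegressionCoeff
    (hz : ∀ i, HasLaw (z i) P Q) (hind : iIndepFun z Q) (hg : MemLp g 2 P)
    (hy : ∀ k, MemLp (y k) 2 P) (hmean : ∀ k, ∫ t, y k t ∂P = 0)
    (horth : Pairwise fun k l => ∫ t, y k t * y l t ∂P = 0) :
    TendstoInDistribution
      (fun (n : ℕ) ω => √(n : ℝ) *
        (sampleMean (fun i => z i ω) n (linearResidual g y fun k =>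
          sampleRegressionCoeff (fun i => z i ω) n g (y k)) - ∫ t, g t ∂P))
      atTop id (fun _ => Q)
      (gaussianReal 0 (⨅ w, variance (linearResidual g y w) P).toNNReal) := by
  have : IsProbabilityMeasure P := (hz 0).isProbabilityMeasure_iff.1 ‹_›
  have hWm (k : ι) (n : ℕ) :=
    aemeasurable_sampleRegressionCoeff hz hg.aemeasurable (hy k).aemeasurable n
  rw [iInf_variance_linearResidual hg hy hmean horth]
  refine tendstoInDistribution_sampleMean_linearResidual_of_tendstoInMeasure hz hind hg hy hmean
    hWm fun k => tendstoInMeasure_of_tendsto_ae (fun n => (hWm k n).aestronglyMeasurable) ?_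
  exact ae_tendsto_sampleRegressionCoeff hz (fun _ _ => hind.indepFun) hg (hy k)

end EstimatedWeights

section ProductMeasure

theorem integral_div_measureReal_singleton {α : Type*} [Fintype α] [MeasurableSpace α]
    [MeasurableSingletonClass α] {ν : Measure α} [IsFiniteMeasure ν] {q : α → ℝ}
    (hq : ∀ a, ν.real {a} = 0 → q a = 0) : ∫ a, q a / ν.real {a} ∂ν = ∑ a, q a := by
  rw [integral_fintype .of_finite]
  exact Finset.sum_congr rfl fun a _ => mul_div_cancel_of_imp' (hq a)

theorem integral_pi_finsetProd {ι : Type*} [Fintype ι] {α : ι → Type*}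
    [∀ i, MeasurableSpace (α i)] (ν : (i : ι) → Measure (α i)) [∀ i, IsProbabilityMeasure (ν i)]
    (s : Finset ι) (f : (i : ι) → α i → ℝ) :
    ∫ a, ∏ i ∈ s, f i (a i) ∂Measure.pi ν = ∏ i ∈ s, ∫ x, f i x ∂ν i := by
  classical
  calc ∫ a, ∏ i ∈ s, f i (a i) ∂Measure.pi ν
      = ∫ a, ∏ i, (if i ∈ s then f i (a i) else 1) ∂Measure.pi ν := by
        simp only [Fintype.prod_ite_mem]
    _ = ∏ i, ∫ x, (if i ∈ s then f i x else 1) ∂ν i :=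
        integral_fintype_prod_eq_prod fun i x => if i ∈ s then f i x else 1
    _ = ∏ i, (if i ∈ s then ∫ x, f i x ∂ν i else 1) :=
        Finset.prod_congr rfl fun i _ => by split_ifs <;> simp
    _ = ∏ i ∈ s, ∫ x, f i x ∂ν i := Fintype.prod_ite_mem _ _

end ProductMeasure

namespace SlateOPE

variable {𝒳 : Type*} [MeasurableSpace 𝒳] {K : ℕ} {d : Fin K → ℕ} {PX : Measure 𝒳}
  {μ : Kernel 𝒳 (Slate d)} {μs : (k : Fin K) → Kernel 𝒳 (Fin (d k))}
  {ρ : Kernel (𝒳 × Slate d) ℝ} {π : Kernel 𝒳 (Slate d)}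

theorem integral_law_fst [SFinite PX] [IsSFiniteKernel μ] [IsMarkovKernel ρ]
    {f : 𝒳 × Slate d → ℝ} (hf : Integrable (fun t => f t.1) (law PX μ ρ)) :
    ∫ t, f t.1 ∂law PX μ ρ = ∫ x, ∫ a, f (x, a) ∂μ x ∂PX := by
  have hint : Integrable f (PX ⊗ₘ μ) := by
    simpa using Integrable.integral_compProd
      (κ := Kernel.const Unit (PX ⊗ₘ μ)) (η := Kernel.prodMkLeft Unit ρ) (a := ()) hf
  rw [law, Measure.integral_compProd hf, ← Measure.integral_compProd hint]
  simp

theorem ae_eq_pi_of_isFactored [IsFiniteKernel μ] [∀ k, IsFiniteKernel (μs k)]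
    (hfac : IsFactored PX μ μs) : ∀ᵐ x ∂PX, μ x = Measure.pi fun k => μs k x := by
  filter_upwards [hfac] with x hx
  refine Measure.ext_of_measureReal_singleton fun a => ?_
  rw [hx]
  simp only [measureReal_def, Measure.pi_singleton, ENNReal.toReal_prod]

theorem sum_slotMarginal [IsMarkovKernel π] (k : Fin K) (x : 𝒳) :
    ∑ j, slotMarginal π k x j = 1 := by
  have h := sum_measureReal_preimage_singleton (μ := π x) (Finset.univ : Finset (Fin (d k)))
    (f := fun a : Slate d => a k) fun _ _ => measurable_pi_apply k (measurableSet_singleton _)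
  simpa [slotMarginal, Set.preimage] using h

theorem integral_slotRatio_sub_one [∀ k, IsMarkovKernel (μs k)] [IsMarkovKernel π] {x : 𝒳}
    {k : Fin K} (hcov : ∀ j, (μs k x).real {j} = 0 → slotMarginal π k x j = 0) :
    ∫ j, (slotMarginal π k x j / (μs k x).real {j} - 1) ∂μs k x = 0 := by
  rw [integral_sub .of_finite .of_finite, integral_div_measureReal_singleton hcov,
    sum_slotMarginal]
  simp

theorem Vstar_eq_iInf_variance_linearResidual (P : Measure (Triplet 𝒳 d)) :
    Vstar P μs π =
      ⨅ w, variance (linearResidual (GR μs π) (fun k t => Y μs π k t - 1) w) P :=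
  rfl

theorem thetaHat_wHat_eq_sampleMean (z : ℕ → Triplet 𝒳 d) (n : ℕ) :
    thetaHat μs π z n (wHat μs π z n) =
      sampleMean z n (linearResidual (GR μs π) (fun k t => Y μs π k t - 1) fun k =>
        sampleRegressionCoeff z n (GR μs π) fun t => Y μs π k t - 1) :=
  rfl

variable [SFinite PX] [IsFiniteKernel μ] [∀ k, IsMarkovKernel (μs k)] [IsMarkovKernel ρ]
  [IsMarkovKernel π]

theorem integral_prod_Y_sub_one (hfac : IsFactored PX μ μs) (hcov : Covers PX μs π)
    {s : Finset (Fin K)} (hs : s.Nonempty)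
    (hint : Integrable (fun t => ∏ k ∈ s, (Y μs π k t - 1)) (law PX μ ρ)) :
    ∫ t, ∏ k ∈ s, (Y μs π k t - 1) ∂law PX μ ρ = 0 := by
  let f (x : 𝒳) (k : Fin K) (j : Fin (d k)) : ℝ :=
    slotMarginal π k x j / (μs k x).real {j} - 1
  calc ∫ t, ∏ k ∈ s, (Y μs π k t - 1) ∂law PX μ ρ
      = ∫ x, ∫ a, ∏ k ∈ s, f x k (a k) ∂μ x ∂PX :=
        integral_law_fst (f := fun u => ∏ k ∈ s, f u.1 k (u.2 k)) hint
    _ = 0 := by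
        refine integral_eq_zero_of_ae ?_
        filter_upwards [ae_eq_pi_of_isFactored hfac, hcov] with x hx hcx
        obtain ⟨k, hk⟩ := hs
        rw [hx, integral_pi_finsetProd]
        exact Finset.prod_eq_zero hk (integral_slotRatio_sub_one (hcx k))

theorem integral_Y_sub_one (hfac : IsFactored PX μ μs) (hcov : Covers PX μs π) {k : Fin K}
    (hint : Integrable (fun t => Y μs π k t - 1) (law PX μ ρ)) :
    ∫ t, (Y μs π k t - 1) ∂law PX μ ρ = 0 := by
  simpa only [Finset.prod_singleton] using integral_prod_Y_sub_one hfac hcov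
    (Finset.singleton_nonempty k) (by simpa only [Finset.prod_singleton] using hint)

theorem integral_Y_sub_one_mul_Y_sub_one (hfac : IsFactored PX μ μs) (hcov : Covers PX μs π)
    {k l : Fin K} (hkl : k ≠ l)
    (hint : Integrable (fun t => (Y μs π k t - 1) * (Y μs π l t - 1)) (law PX μ ρ)) :
    ∫ t, (Y μs π k t - 1) * (Y μs π l t - 1) ∂law PX μ ρ = 0 := by
  simpa only [Finset.prod_pair hkl] using integral_prod_Y_sub_one hfac hcov
    (Finset.insert_nonempty k {l}) (by simpa only [Finset.prod_pair hkl] using hint)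

end SlateOPE

theorem lemma9 {𝒳 : Type*} [MeasurableSpace 𝒳] {K : ℕ} {d : Fin K → ℕ}
    -- context distribution, logging policy with its slot policies, reward model, target policy
    (PX : Measure 𝒳) [IsProbabilityMeasure PX]
    (μ : Kernel 𝒳 (SlateOPE.Slate d)) [IsMarkovKernel μ]
    (μs : (k : Fin K) → Kernel 𝒳 (Fin (d k))) [∀ k, IsMarkovKernel (μs k)]
    (ρ : Kernel (𝒳 × SlateOPE.Slate d) ℝ) [IsMarkovKernel ρ]
    (π : Kernel 𝒳 (SlateOPE.Slate d)) [IsMarkovKernel π]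
    (hfac : SlateOPE.IsFactored PX μ μs)
    (hcov : SlateOPE.Covers PX μs π)
    -- finite second moments
    (hGR : MemLp (SlateOPE.GR μs π) 2 (SlateOPE.law PX μ ρ))
    (hY : ∀ k, MemLp (SlateOPE.Y μs π k) 2 (SlateOPE.law PX μ ρ))
    -- iid data
    {Ω : Type*} [MeasurableSpace Ω] (Q : Measure Ω) [IsProbabilityMeasure Q]
    (X : ℕ → Ω → 𝒳) (A : ℕ → Ω → SlateOPE.Slate d) (R : ℕ → Ω → ℝ)
    (hlaw : ∀ i, HasLaw (fun ω => ((X i ω, A i ω), R i ω)) (SlateOPE.law PX μ ρ) Q)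
    (hind : iIndepFun (fun i ω => ((X i ω, A i ω), R i ω)) Q) :
    TendstoInDistribution
      (fun (n : ℕ) (ω : Ω) =>
        √(n : ℝ) *
          (SlateOPE.thetaHat μs π (fun i => ((X i ω, A i ω), R i ω)) n
              (SlateOPE.wHat μs π (fun i => ((X i ω, A i ω), R i ω)) n)
            - SlateOPE.theta (SlateOPE.law PX μ ρ) μs π))
      atTop id (fun _ => Q)
      (gaussianReal 0 (SlateOPE.Vstar (SlateOPE.law PX μ ρ) μs π).toNNReal) := by
  have : IsProbabilityMeasure (SlateOPE.law PX μ ρ) :=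
    inferInstanceAs (IsProbabilityMeasure ((PX ⊗ₘ μ) ⊗ₘ ρ))
  have hcentred (k : Fin K) :
      MemLp (fun t => SlateOPE.Y μs π k t - 1) 2 (SlateOPE.law PX μ ρ) :=
    (hY k).sub (memLp_const 1)
  simp only [SlateOPE.thetaHat_wHat_eq_sampleMean,
    SlateOPE.Vstar_eq_iInf_variance_linearResidual, SlateOPE.theta]
  exact tendstoInDistribution_sampleMean_linearResidual_sampleRegressionCoeff hlaw hind hGR hcentred
    (fun k => SlateOPE.integral_Y_sub_one hfac hcov ((hcentred k).integrable one_le_two))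
    fun k l hkl => SlateOPE.integral_Y_sub_one_mul_Y_sub_one hfac hcov hkl
      ((hcentred k).integrable_mul (hcentred l))
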